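/- Let $f(x)=\frac1N\sum_{i=1}^N f(x,i)$ on $\mathbb R^n$, $N\ge 1$, where each $f(\cdot,i):\mathbb R^n\to\mathbb R$ is continuously differentiable, bounded from below, and has an $\mathsf L$-Lipschitz continuous gradient. Let $\mathrm{crit}(f):=\{x:\nabla f(x)=0\}$. Let $\alpha>0$, $\beta\ge 0$, $\gamma\in(\frac12,1]$ and $\alpha_t=\alpha/(t+\beta)^\gamma$ for $t\ge1$. On a probability space $(\Omega,\mathcal F,\mathbb P)$ let $\{X^t\}$ be a stochastic process generated by the shuffled proximal point method: $X^0=x^0\in\mathbb R^n$, and in each iteration $t\ge 1$ one draws a uniformly random permutation $\sigma^t$ of $\{1,\dots,N\}$ (independently over $t$), sets $\tilde x^t_0=X^{t-1}$, chooses $$\tilde x^t_i\in\operatorname*{argmin}_{x\in\mathbb R^n}\; f(x,\sigma^t_i)+\frac1{2\alpha_t}\|x-\tilde x^t_{i-1}\|^2,\qquad i=1,\dots,N,$$ and sets $X^t=\tilde x^t_N$. We say that $f$ satisfies the KL inequality at $\bar x$ with exponent $\theta\in[0,1)$ if there are $c>0$, $\eta\in(0,\infty]$ and a neighborhood $U$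 of $\bar x$ such that, with $\varrho(s)=cs^{1-\theta}$, $\varrho'(|f(x)-f(\bar x)|)\,\|\nabla f(x)\|\ge 1$ for all $x\in U$ with $0<|f(x)-f(\bar x)|<\eta$. Assume that (i) $\sup_t\|X^t\|<\infty$ almost surely; (ii) there is an event $\mathcal K$ with $\mathbb P(\mathcal K)=1$ such that, for every $\omega\in\mathcal K$, $f$ satisfies the KL inequality with some exponent in $[0,1)$ at every accumulation point of $\{X^t(\omega)\}_{t\ge1}$ (the exponent and the constants may depend on the point). Then $\{X^t\}_{t\ge1}$ converges almost surely to a random vector $X^*:\Omega\to\mathrm{crit}(f)$. Almost surely, $f$ satisfies the KL inequality at $X^*(\omega)$ with some exponent in $[0,1)$. If $\Theta(\omega)\in[0,1)$ denotes, for almost every $\omega$, such an exponent of $f$ at $X^*(\omega)$, then $$\limsup_{t\to\infty}\;t^{\Psi_\gamma(\omega)}\,\|X^t(\omega)-X^*(\omega)\|<\infty\quad\text{almost surely},$$ where $$\Psi_\gamma(\omega)=\begin{cases}2\gamma-1&\text{if }\Theta(\omega)<\frac{\gamma}{3\gamma-1},\\[2pt] \frac{(1-\Theta(\omega))(1-\gamma)}{2\Theta(\omega)-1}&\text{if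 }\Theta(\omega)\ge\frac{\gamma}{3\gamma-1}\text{ and }(\Theta(\omega),\gamma)\ne(\frac12,1),\\[2pt] 0&\text{otherwise.}\end{cases}$$ -/

import Mathlib

open Set Filter Topology MeasureTheory ProbabilityTheory
open scoped NNReal ENNReal

noncomputable section

namespace ShuffledProx

/-- The finite-sum objective `f(x) = (1/N) ∑ᵢ f(x, i)`. -/
def objective {n N : ℕ} (F : Fin N → EuclideanSpace ℝ (Fin n) → ℝ)
    (x : EuclideanSpace ℝ (Fin n)) : ℝ :=
  (1 / (N : ℝ)) * ∑ i, F i x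

/-- The set of critical (stationary) points of a smooth function. -/
def crit {n : ℕ} (f : EuclideanSpace ℝ (Fin n) → ℝ) : Set (EuclideanSpace ℝ (Fin n)) :=
  {x | gradient f x = 0}

/-- The step sizes `α_t = α / (t + β)^γ` (used for `t ≥ 1`). -/
def stepSize (α β γ : ℝ) (t : ℕ) : ℝ :=
  α / ((t : ℝ) + β) ^ γ

/-- `z ∈ argmin_x g(x) + (1 / (2a)) ‖x - y‖²`: `z` is a global minimizer. -/
def IsProx {n : ℕ} (g : EuclideanSpace ℝ (Fin n) → ℝ) (a : ℝ)
    (y z : EuclideanSpace ℝ (Fin n)) : Prop :=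
  IsMinOn (fun x => g x + 1 / (2 * a) * ‖x - y‖ ^ 2) univ z

/-- `X` is a stochastic process generated by the shuffled proximal point method with component
functions `F`, step sizes `a t` (`t ≥ 1`) and initial point `x0`. The random permutation of
epoch `t ≥ 1` is `σ t`, and `inner t ω i` is the `i`-th inner iterate of epoch `t`,
`i = 0, …, N`. The permutations are i.i.d. and uniform. As `Fin N` is numbered from `0`, the
`(i+1)`-st inner iterate is computed with the component `σ t ω i`. -/
structure IsShuffledProximalPoint {Ω : Type*} [MeasurableSpace Ω] (P : Measure Ω) {n N : ℕ}
    (F : Fin N → EuclideanSpace ℝ (Fin n) → ℝ) (a : ℕ → ℝ)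
    (x0 : EuclideanSpace ℝ (Fin n)) (σ : ℕ → Ω → Equiv.Perm (Fin N))
    (inner : ℕ → Ω → ℕ → EuclideanSpace ℝ (Fin n))
    (X : ℕ → Ω → EuclideanSpace ℝ (Fin n)) : Prop where
  measurable_perm : ∀ t π, MeasurableSet {ω | σ (t + 1) ω = π}
  uniform_perm : ∀ t π, P {ω | σ (t + 1) ω = π} = ((N.factorial : ℝ≥0∞))⁻¹
  indep_perm : iIndepFun (m := fun _ : ℕ => (⊤ : MeasurableSpace (Equiv.Perm (Fin N))))
    (fun t => σ (t + 1)) P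
  measurable_iterate : ∀ t, Measurable (X t)
  init : ∀ ω, X 0 ω = x0
  inner_zero : ∀ t ω, inner (t + 1) ω 0 = X t ω
  inner_step : ∀ t ω (i : Fin N),
    IsProx (F (σ (t + 1) ω i)) (a (t + 1)) (inner (t + 1) ω i) (inner (t + 1) ω (i + 1))
  iterate_succ : ∀ t ω, X (t + 1) ω = inner (t + 1) ω N

/-- The set of accumulation points of a sequence. -/
def accPoints {n : ℕ} (x : ℕ → EuclideanSpace ℝ (Fin n)) : Set (EuclideanSpace ℝ (Fin n)) :=
  {z | ∃ φ : ℕ → ℕ, StrictMono φ ∧ Tendsto (fun l => x (φ l)) atTop (𝓝 z)}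

/-- The KL inequality of `f` at `xbar` with desingularizing function `ϱ`, in the variant with
the absolute value of `f x - f xbar`: for some `η ∈ (0, ∞]` and some neighbourhood `U` of `xbar`,
`ϱ'(|f x - f xbar|) ‖∇f x‖ ≥ 1` for all `x ∈ U` with `0 < |f x - f xbar| < η`. -/
def KLInequalityWith {n : ℕ} (f : EuclideanSpace ℝ (Fin n) → ℝ)
    (xbar : EuclideanSpace ℝ (Fin n)) (ϱ : ℝ → ℝ) : Prop :=
  ∃ η : EReal, 0 < η ∧ ∃ U ∈ 𝓝 xbar, ∀ x ∈ U,
    0 < |f x - f xbar| → ((|f x - f xbar| : ℝ) : EReal) < η →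
      1 ≤ deriv ϱ |f x - f xbar| * ‖gradient f x‖

/-- The function `s ↦ c s^(1-θ)`. -/
def lojasiewicz (c θ : ℝ) (s : ℝ) : ℝ := c * s ^ (1 - θ)

/-- `f` satisfies the KL inequality at `xbar` with exponent `θ ∈ [0, 1)`, i.e. with some
Łojasiewicz function `ϱ(s) = c s^(1-θ)`, `c > 0`. -/
def HasKLExponent {n : ℕ} (f : EuclideanSpace ℝ (Fin n) → ℝ)
    (xbar : EuclideanSpace ℝ (Fin n)) (θ : ℝ) : Prop :=
  θ ∈ Ico (0 : ℝ) 1 ∧ ∃ c : ℝ, 0 < c ∧ KLInequalityWith f xbar (lojasiewicz c θ)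

open scoped Classical in
/-- The rate exponent as a function of the step size parameter `γ` and the KL exponent `θ`. -/
def rate (γ θ : ℝ) : ℝ :=
  if θ < γ / (3 * γ - 1) then 2 * γ - 1
  else if (θ, γ) ≠ ((1 / 2 : ℝ), (1 : ℝ)) then (1 - θ) * (1 - γ) / (2 * θ - 1)
  else 0

end ShuffledProx

end

namespace ShuffledProx

/-! ### Real-variable estimates -/

/-! The argument is pathwise. Stationarity of each proximal step gives an implicit gradient step,
and over one epoch the order of the components only enters at second order: along a bounded path, `x
(t + 1) = x t - h ∇f (x t) + O(h ^ 2)` with `h = N α_{t+1}` (`norm_implicit_epoch_le`). Hence `f`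
decreases by a multiple of `h ‖∇f‖ ^ 2` up to `O(h ^ 3)`; this is all that `IsPerturbedDescent`
retains.

With `s = t + b`, adding `U s ^ (-(3γ-1))` to `f (x t)` absorbs the errors `s ^ (-3γ)`, so the merit
`w` decreases to `0`. The KL inequality bounds `s ^ (-γ) ‖∇f‖` by a decrement of `w ^ (1-θ)` plus
`O(s ^ (-γ-(3γ-1)θ))`. The last term is `O(s ^ (-2γ))`, like the step error, exactly when `θ ≥
γ/(3γ-1)`; since KL exponents may be raised, this is no loss. The steps are thus dominated by
decrements of a vanishing sequence, which traps the path at its accumulation point and gives `‖x t -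
z‖ = O(w ^ (1-θ) + s ^ (-(2γ-1)))`.

For the rate, the squared KL inequality yields `w' ≤ w - c s ^ (-γ) w ^ (2θ) + C s ^ (-p-1)`, and
the Chung-type lemma gives `w = O(s ^ (-p))` with `p = (1-γ)/(2θ-1)` if `γ < 1`. For `γ = 1` and `Θ
< 1/2` one takes `θ = 1/2`, `p = 2`. -/

theorem one_sub_mul_le_one_add_rpow_neg {x p : ℝ} (hx : -1 < x) (hp : 0 ≤ p) :
    1 - p * x ≤ (1 + x) ^ (-p) := by
  have h0 : 0 < 1 + x := by linarith
  rw [Real.rpow_def_of_pos h0]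
  have h1 := Real.add_one_le_exp (Real.log (1 + x) * -p)
  have h2 := Real.log_le_sub_one_of_pos h0
  nlinarith

theorem rpow_neg_sub_le_add_one_rpow_neg {s p : ℝ} (hs : 0 < s) (hp : 0 ≤ p) :
    s ^ (-p) - p * s ^ (-p - 1) ≤ (s + 1) ^ (-p) := by
  have h1 : s + 1 = s * (1 + 1 / s) := by field_simp
  have h2 : 0 < 1 / s := by positivity
  have h3 := one_sub_mul_le_one_add_rpow_neg (x := 1 / s) (p := p) (by linarith) hp
  have h4 : 0 ≤ s ^ (-p) := by positivity
  rw [h1, Real.mul_rpow hs.le (by positivity), Real.rpow_sub_one hs.ne']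
  calc s ^ (-p) - p * (s ^ (-p) / s) = s ^ (-p) * (1 - p * (1 / s)) := by ring
    _ ≤ _ := mul_le_mul_of_nonneg_left h3 h4

/-- This replaces summation of series: an error `s ^ (-q-1)` is paid for by a decrement of `s ^
(-q)`. The factor `2 ^ (-q-1)` comes from `s + 1 ≤ 2 s`. -/
theorem rpow_neg_sub_add_one_rpow_neg_ge {s q : ℝ} (hs : 1 ≤ s) (hq : 0 ≤ q) :
    q * 2 ^ (-q - 1) * s ^ (-q - 1) ≤ s ^ (-q) - (s + 1) ^ (-q) := by
  have hs0 : 0 < s := by linarith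
  have hr : 0 < s + 1 := by linarith
  have h1 : s = (s + 1) * (1 + -(1 / (s + 1))) := by field_simp; ring
  have hlt : 1 / (s + 1) < 1 := by rw [div_lt_one hr]; linarith
  have h3 := one_sub_mul_le_one_add_rpow_neg (x := -(1 / (s + 1))) (p := q) (by linarith) hq
  have h4 : (s + 1) ^ (-q) + q * (s + 1) ^ (-q - 1) ≤ s ^ (-q) := by
    conv_rhs => rw [h1]
    rw [Real.mul_rpow hr.le (by linarith), Real.rpow_sub_one hr.ne']
    calc (s + 1) ^ (-q) + q * ((s + 1) ^ (-q) / (s + 1))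
        = (s + 1) ^ (-q) * (1 - q * -(1 / (s + 1))) := by ring
      _ ≤ _ := mul_le_mul_of_nonneg_left h3 (by positivity)
  have h5 : (2 * s) ^ (-q - 1) ≤ (s + 1) ^ (-q - 1) :=
    Real.rpow_le_rpow_of_nonpos hr (by linarith) (by linarith)
  rw [Real.mul_rpow (by norm_num) hs0.le] at h5
  nlinarith [mul_le_mul_of_nonneg_left h5 hq]

/-- A Chung-type lemma: the recursion `w' ≤ w - c s^(-γ) w^q + C s^(-p-1)` with
`p q + γ = p + 1` forces `w = O(s^(-p))`. -/
theorem exists_eventually_le_rpow_of_recursion {w : ℕ → ℝ} {b c C p q γ : ℝ} (hb : 1 ≤ b)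
    (hp : 0 < p) (hc : 0 ≤ c) (hC : 0 ≤ C) (hq : 0 ≤ q) (hpq : p * q + γ = p + 1)
    (hK : ∀ᶠ K : ℝ in atTop, K * p + C ≤ c * (K / 2) ^ q)
    (hw : ∀ᶠ t in atTop, 0 ≤ w t)
    (hrec : ∀ᶠ t : ℕ in atTop, w (t + 1) ≤
      w t - c * (t + b) ^ (-γ) * w t ^ q + C * (t + b) ^ (-p - 1)) :
    ∃ K, ∀ᶠ t : ℕ in atTop, w t ≤ K * (t + b) ^ (-p) := by
  obtain ⟨T, hT⟩ := eventually_atTop.1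
    ((hw.and hrec).and (tendsto_natCast_atTop_atTop.eventually_ge_atTop (4 * p)))
  obtain ⟨K, ⟨hK1, hK2⟩, hK3⟩ := ((hK.and (eventually_ge_atTop (4 * C))).and
    (eventually_ge_atTop (w T * (T + b) ^ p))).exists
  refine ⟨K, eventually_atTop.2 ⟨T, fun t ht => ?_⟩⟩
  induction t, ht using Nat.le_induction with
  | base =>
    have hs : (0 : ℝ) < T + b := by positivity
    rw [Real.rpow_neg hs.le, ← div_eq_mul_inv, le_div_iff₀ (by positivity)]
    exact hK3
  | succ t ht ih =>
    obtain ⟨⟨hw0, hr⟩, h4p⟩ := hT t ht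
    push_cast
    set s : ℝ := t + b with hsdef
    have hs1 : 1 ≤ s := by have : (0 : ℝ) ≤ t := by positivity
                           linarith
    have hs : 0 < s := by linarith
    have hB := rpow_neg_sub_le_add_one_rpow_neg hs hp.le
    have hK0 : 0 ≤ K := by linarith
    rw [show (t : ℝ) + 1 + b = s + 1 by ring]
    have hsp : 0 < s ^ (-p) := by positivity
    have hsp1 : 0 < s ^ (-p - 1) := by positivity
    have hexp : s ^ (-p - 1) * s = s ^ (-p) := by
      rw [Real.rpow_sub_one hs.ne']; field_simp
    have hBK := mul_le_mul_of_nonneg_left hB hK0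
    -- The bound `K s ^ (-p)` drops by at most `K p s ^ (-p-1)`. If `w t` exceeds half of it, the
    -- term `w ^ q` outweighs this drop and the error by `hK1`; otherwise the spare half covers
    -- both, a quarter each.
    rcases le_total (K / 2 * s ^ (-p)) (w t) with h | h
    · have h1 : (K / 2) ^ q * s ^ (-p * q) ≤ w t ^ q := by
        rw [Real.rpow_mul hs.le, ← Real.mul_rpow (by linarith) hsp.le]
        exact Real.rpow_le_rpow (by positivity) h hq
      have h2 : s ^ (-γ) * s ^ (-p * q) = s ^ (-p - 1) := by
        rw [← Real.rpow_add hs]; congr 1; linarith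
      have h3 : c * (K / 2) ^ q * s ^ (-p - 1) ≤ c * s ^ (-γ) * w t ^ q := by
        rw [← h2]
        calc _ = c * s ^ (-γ) * ((K / 2) ^ q * s ^ (-p * q)) := by ring
          _ ≤ _ := mul_le_mul_of_nonneg_left h1 (by positivity)
      have h4 := mul_le_mul_of_nonneg_right hK1 hsp1.le
      linarith
    · have h1 : 0 ≤ c * s ^ (-γ) * w t ^ q := by positivity
      have h2 : p * s ^ (-p - 1) ≤ s ^ (-p) / 4 := by
        rw [← hexp]; nlinarith
      have h3 : K * (p * s ^ (-p - 1)) ≤ K * (s ^ (-p) / 4) := mul_le_mul_of_nonneg_left h2 hK0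
      have h4 : C * s ^ (-p - 1) ≤ K / 4 * s ^ (-p) := by
        have : s ^ (-p - 1) ≤ s ^ (-p) := by rw [← hexp]; nlinarith
        nlinarith
      linarith

/-- The one-step length estimate behind the finite length property. -/
theorem mul_le_rpow_sub_rpow_add {w w' D u G h c M θ : ℝ} (hw' : 0 ≤ w')
    (hu : 0 ≤ u) (hD : 0 ≤ D) (hh : 0 < h) (hc : 0 < c) (hM : 0 < M)
    (hθ : θ ∈ Ioo (0 : ℝ) 1) (hwD : w ≤ D + u) (hKL : M * D ^ θ ≤ G)
    (hdesc : w' + c * h * G ^ 2 ≤ w) :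
    h * G ≤ 1 / (c * M * (1 - θ)) * (w ^ (1 - θ) - w' ^ (1 - θ)) + M * (h * u ^ θ) := by
  obtain ⟨hθ0, hθ1⟩ := hθ
  have hθ' : 0 < 1 - θ := by linarith
  have hnn : 0 ≤ c * h * G ^ 2 := by positivity
  have hw : 0 ≤ w := by linarith
  rcases hw.eq_or_lt with h0 | h0
  · have e1 : w' = 0 := by linarith
    have e2 : G = 0 := by
      have : c * h * G ^ 2 = 0 := by linarith
      simpa [hc.ne', hh.ne'] using this
    rw [e1, e2, ← h0]
    simp only [sub_self, mul_zero, zero_add]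
    positivity
  · have hwθ : 0 < w ^ θ := by positivity
    -- Concavity of `r ↦ r ^ (1-θ)`, via Bernoulli's inequality at `w' / w`.
    have hconc : (1 - θ) * (w - w') ≤ w ^ θ * (w ^ (1 - θ) - w' ^ (1 - θ)) := by
      have hx : -1 ≤ (w' - w) / w := by rw [le_div_iff₀ h0]; linarith
      have := rpow_one_add_le_one_add_mul_self hx hθ'.le (by linarith)
      rw [show 1 + (w' - w) / w = w' / w by field_simp; ring, Real.div_rpow hw' hw,
        div_le_iff₀ (by positivity)] at this
      have hprod : w ^ θ * w ^ (1 - θ) = w := by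
        rw [← Real.rpow_add h0]; simp
      have h2 := mul_le_mul_of_nonneg_left this hwθ.le
      have h3 : w ^ θ * ((1 + (1 - θ) * ((w' - w) / w)) * w ^ (1 - θ))
          = w + (1 - θ) * (w' - w) := by
        calc _ = (w ^ θ * w ^ (1 - θ)) * (1 + (1 - θ) * ((w' - w) / w)) := by ring
          _ = _ := by rw [hprod]; field_simp
      rw [h3] at h2
      linarith
    have hsub : M * w ^ θ ≤ G + M * u ^ θ := by
      have h1 : w ^ θ ≤ D ^ θ + u ^ θ :=
        (Real.rpow_le_rpow hw hwD hθ0.le).trans (Real.rpow_add_le_add_rpow hD hu hθ0.le hθ1.le)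
      nlinarith
    have huθ : 0 ≤ u ^ θ := by positivity
    set A := w ^ θ
    set B := u ^ θ
    set φ := w ^ (1 - θ) - w' ^ (1 - θ)
    have h1 : (1 - θ) * (c * h * G ^ 2) ≤ A * φ := by nlinarith
    have h2 : A * (c * M * (1 - θ) * (h * G) - c * M * (1 - θ) * (M * (h * B)))
        ≤ A * φ := by
      refine le_trans ?_ h1
      -- By `hsub`, `M A ≤ G + M B`, so when `G ≥ M B` the left side is at most `G ^ 2 - (M B) ^ 2`.
      have : A * (M * (G - M * B)) ≤ G ^ 2 := by
        rcases le_total (G - M * B) 0 with hn | hn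
        · have : A * (M * (G - M * B)) ≤ 0 := by
            have : 0 ≤ A * M := by positivity
            nlinarith
          nlinarith
        · have h4 : (M * A) * (G - M * B) ≤ (G + M * B) * (G - M * B) :=
            mul_le_mul_of_nonneg_right hsub hn
          nlinarith [sq_nonneg (M * B)]
      have h5 := mul_le_mul_of_nonneg_left this (show 0 ≤ (1 - θ) * (c * h) by positivity)
      nlinarith
    have h3 := le_of_mul_le_mul_left h2 hwθ
    have hk : 0 < c * M * (1 - θ) := by positivity
    rw [div_mul_eq_mul_div, one_mul, ← sub_le_iff_le_add, le_div_iff₀ hk]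
    linarith

/-- Trapping: a sequence with an accumulation point `z` whose steps are controlled near `z` by
the decrements of a vanishing sequence converges to `z`. -/
theorem tendsto_of_norm_sub_le_decrement {E : Type*} [NormedAddCommGroup E] {x : ℕ → E} {z : E}
    {φ : ℕ → ℕ} (hφ : StrictMono φ) (hz : Tendsto (fun l => x (φ l)) atTop (𝓝 z))
    {Δ : ℕ → ℝ} (hΔ : Tendsto Δ atTop (𝓝 0)) (hΔ0 : ∀ᶠ t in atTop, 0 ≤ Δ t)
    {s : Set E} (hs : s ∈ 𝓝 z)
    (hstep : ∀ᶠ t in atTop, x t ∈ s → ‖x (t + 1) - x t‖ ≤ Δ t - Δ (t + 1)) :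
    Tendsto x atTop (𝓝 z) ∧ ∀ᶠ t in atTop, ‖x t - z‖ ≤ Δ t := by
  obtain ⟨r, hr, hball⟩ := Metric.mem_nhds_iff.1 hs
  obtain ⟨T, hT⟩ := eventually_atTop.1
    ((hΔ0.and hstep).and (hΔ.eventually (gt_mem_nhds (half_pos hr))))
  have hev : ∀ᶠ l in atTop, T ≤ φ l ∧ x (φ l) ∈ Metric.ball z (r / 2) :=
    (hφ.tendsto_atTop.eventually_ge_atTop T).and
      (hz.eventually (Metric.ball_mem_nhds z (half_pos hr)))
  obtain ⟨l, hl, hxl⟩ := hev.exists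
  set t0 := φ l
  rw [mem_ball_iff_norm] at hxl
  -- The path starts within `r / 2` of `z` and has less than `r / 2` of length to spend, so it never
  -- leaves the ball on which the step bound holds.
  have key : ∀ t, t0 ≤ t → ‖x t - x t0‖ ≤ Δ t0 - Δ t ∧ x t ∈ s := by
    intro t ht
    have hmem : ∀ t, t0 ≤ t → ‖x t - x t0‖ ≤ Δ t0 - Δ t → x t ∈ s := by
      intro t ht h
      apply hball
      rw [mem_ball_iff_norm]
      have h1 := (hT t (hl.trans ht)).1.1
      have h2 := (hT t0 hl).2
      have h3 := norm_sub_le_norm_sub_add_norm_sub (x t) (x t0) z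
      linarith
    induction t, ht using Nat.le_induction with
    | base =>
      have : ‖x t0 - x t0‖ ≤ Δ t0 - Δ t0 := by simp
      exact ⟨this, hmem t0 le_rfl this⟩
    | succ t ht ih =>
      have h1 := (hT t (hl.trans ht)).1.2 ih.2
      have h3 := norm_sub_le_norm_sub_add_norm_sub (x (t + 1)) (x t) (x t0)
      have : ‖x (t + 1) - x t0‖ ≤ Δ t0 - Δ (t + 1) := by linarith [ih.1]
      exact ⟨this, hmem _ (by omega) this⟩
  have pair : ∀ t, t0 ≤ t → ∀ t', t ≤ t' → ‖x t' - x t‖ ≤ Δ t - Δ t' := by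
    intro t ht t' ht'
    induction t', ht' using Nat.le_induction with
    | base => simp
    | succ t' ht' ih =>
      have h1 := (hT t' (by omega)).1.2 (key t' (by omega)).2
      have h3 := norm_sub_le_norm_sub_add_norm_sub (x (t' + 1)) (x t') (x t)
      linarith
  have bound : ∀ t, t0 ≤ t → ‖x t - z‖ ≤ Δ t := by
    intro t ht
    have h1 : Tendsto (fun l => ‖x (φ l) - x t‖) atTop (𝓝 ‖z - x t‖) :=
      (hz.sub_const _).norm
    rw [norm_sub_rev]
    refine le_of_tendsto h1 ?_
    filter_upwards [hφ.tendsto_atTop.eventually_ge_atTop t] with l hl'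
    have := pair t ht _ hl'
    have := (hT (φ l) (by omega)).1.1
    linarith
  have bound' : ∀ᶠ t in atTop, ‖x t - z‖ ≤ Δ t := eventually_atTop.2 ⟨t0, bound⟩
  refine ⟨?_, bound'⟩
  rw [tendsto_iff_norm_sub_tendsto_zero]
  exact squeeze_zero' (Eventually.of_forall fun _ => norm_nonneg _) bound' hΔ

end ShuffledProx

namespace ShuffledProx

/-! ### Perturbed descent sequences under the KL inequality -/

theorem tendsto_natCast_add_rpow_neg {b q : ℝ} (hq : 0 < q) :
    Tendsto (fun t : ℕ => ((t : ℝ) + b) ^ (-q)) atTop (𝓝 0) :=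
  (tendsto_rpow_neg_atTop hq).comp
    (tendsto_atTop_add_const_right _ b tendsto_natCast_atTop_atTop)

/-- The sequence `x` satisfies, for all large `t`, the descent and step length estimates of a
gradient method with step sizes of order `s^(-γ)`, `s = t + b`, and errors of order `s^(-2γ)`;
here `G` stands for the norm of the gradient of `f`. -/
structure IsPerturbedDescent {E : Type*} [NormedAddCommGroup E] (f G : E → ℝ) (γ b c C : ℝ)
    (x : ℕ → E) : Prop where
  one_le : 1 ≤ b
  mem_Ioc : γ ∈ Ioc (1 / 2 : ℝ) 1
  pos : 0 < c
  nonneg : 0 ≤ C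
  descent : ∀ᶠ t : ℕ in atTop, f (x (t + 1)) ≤
    f (x t) - c * (t + b) ^ (-γ) * G (x t) ^ 2 + C * (t + b) ^ (-(3 * γ))
  step : ∀ᶠ t : ℕ in atTop, ‖x (t + 1) - x t‖ ≤
    C * ((t + b) ^ (-γ) * G (x t)) + C * (t + b) ^ (-(2 * γ))

/-- The merit sequence `w` is a Lyapunov sequence for `x`, with limiting value `fs` of `f`. -/
structure IsMerit {E : Type*} (f G : E → ℝ) (γ b c : ℝ) (x : ℕ → E) (fs U : ℝ)
    (w : ℕ → ℝ) : Prop where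
  nonneg_const : 0 ≤ U
  eq : ∀ t : ℕ, w t = f (x t) - fs + U * (t + b) ^ (-(3 * γ - 1))
  tendsto : Tendsto w atTop (𝓝 0)
  nonneg : ∀ᶠ t in atTop, 0 ≤ w t
  decr : ∀ᶠ t : ℕ in atTop, w (t + 1) + c * (t + b) ^ (-γ) * G (x t) ^ 2 ≤ w t

theorem IsMerit.tendsto_value {E : Type*} {f G : E → ℝ} {γ b c : ℝ} {x : ℕ → E}
    {fs U : ℝ} {w : ℕ → ℝ} (hw : IsMerit f G γ b c x fs U w)
    (hγ : 1 / 2 < γ) : Tendsto (fun t => f (x t)) atTop (𝓝 fs) := by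
  have h1 := (tendsto_natCast_add_rpow_neg (b := b) (q := 3 * γ - 1) (by linarith)).const_mul U
  have h2 := (hw.tendsto.sub h1).add_const fs
  simp only [mul_zero, sub_zero, zero_add] at h2
  refine h2.congr fun t => ?_
  rw [hw.eq t]; ring

section

variable {E : Type*} [NormedAddCommGroup E] {f G : E → ℝ} {γ b c C : ℝ} {x : ℕ → E}

/-- The weight `C / κ` is chosen so that one decrement of `C / κ * s ^ (-(3γ-1))` covers the error
`C s ^ (-3γ)`. The corrected values are eventually decreasing and bounded below, and `fs` is their
limit. -/
theorem IsPerturbedDescent.exists_isMerit (h : IsPerturbedDescent f G γ b c C x)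
    (hbdd : BddBelow (range fun t => f (x t))) : ∃ fs U w, IsMerit f G γ b c x fs U w := by
  obtain ⟨hb, ⟨hγ, hγ1⟩, hc, hC, hdesc, -⟩ := h
  have hq : 0 < 3 * γ - 1 := by linarith
  set q := 3 * γ - 1 with hqdef
  set κ : ℝ := q * 2 ^ (-q - 1)
  have hκ : 0 < κ := by positivity
  set y : ℕ → ℝ := fun t => f (x t) + C / κ * (t + b) ^ (-q) with hy
  have hdecr : ∀ᶠ t : ℕ in atTop, y (t + 1) + c * (t + b) ^ (-γ) * G (x t) ^ 2 ≤ y t := by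
    filter_upwards [hdesc] with t ht
    have hs : 1 ≤ (t : ℝ) + b := by
      have : (0 : ℝ) ≤ t := by positivity
      linarith
    have h1 := rpow_neg_sub_add_one_rpow_neg_ge hs hq.le
    have h2 := mul_le_mul_of_nonneg_left h1 (show 0 ≤ C / κ by positivity)
    have h3 : C / κ * (κ * ((t : ℝ) + b) ^ (-q - 1)) = C * (t + b) ^ (-(3 * γ)) := by
      rw [← mul_assoc, div_mul_cancel₀ _ hκ.ne']; congr 2; rw [hqdef]; ring
    rw [h3] at h2
    simp only [hy]
    push_cast
    rw [show (t : ℝ) + 1 + b = t + b + 1 by ring]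
    linarith
  obtain ⟨T, hT⟩ := eventually_atTop.1 hdecr
  obtain ⟨B, hB⟩ := hbdd
  have hyB : ∀ t, B ≤ y t := by
    intro t
    have h1 : B ≤ f (x t) := hB ⟨t, rfl⟩
    have h2 : (0 : ℝ) ≤ C / κ * (t + b) ^ (-q) := by positivity
    simp only [hy]; linarith
  have hanti : Antitone fun t => y (t + T) := by
    refine antitone_nat_of_succ_le fun t => ?_
    have h1 := hT (t + T) (by omega)
    have h2 : 0 ≤ c * ((t + T : ℕ) + b) ^ (-γ) * G (x (t + T)) ^ 2 := by positivity
    rw [show t + 1 + T = t + T + 1 by ring]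
    linarith
  have hbd : BddBelow (range fun t => y (t + T)) := ⟨B, by rintro _ ⟨t, rfl⟩; exact hyB _⟩
  have hlim := tendsto_atTop_ciInf hanti hbd
  set fs := ⨅ t, y (t + T)
  have hlim' : Tendsto y atTop (𝓝 fs) := (tendsto_add_atTop_iff_nat T).1 hlim
  refine ⟨fs, C / κ, fun t => y t - fs, by positivity, fun t => by simp only [hy]; ring, ?_, ?_, ?_⟩
  · simpa using hlim'.sub_const fs
  · filter_upwards [eventually_ge_atTop T] with t ht
    have := ciInf_le hbd (t - T)
    simp only [Nat.sub_add_cancel ht] at this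
    exact sub_nonneg.2 this
  · filter_upwards [hdecr] with t ht
    linarith

theorem IsMerit.eq_of_accPoint {fs U : ℝ} {w : ℕ → ℝ} (hw : IsMerit f G γ b c x fs U w)
    (hγ : 1 / 2 < γ) {z : E} (hf : ContinuousAt f z) {φ : ℕ → ℕ} (hφ : StrictMono φ)
    (hz : Tendsto (fun l => x (φ l)) atTop (𝓝 z)) : fs = f z :=
  tendsto_nhds_unique ((hw.tendsto_value hγ).comp hφ.tendsto_atTop) (hf.tendsto.comp hz)

/-- Under the KL inequality at an accumulation point, the whole sequence converges, and the
distance to the limit is controlled by the merit sequence. -/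
theorem IsPerturbedDescent.tendsto_of_kl (h : IsPerturbedDescent f G γ b c C x)
    {fs U : ℝ} {w : ℕ → ℝ} (hw : IsMerit f G γ b c x fs U w)
    {z : E} (hf : ContinuousAt f z) {φ : ℕ → ℕ} (hφ : StrictMono φ)
    (hz : Tendsto (fun l => x (φ l)) atTop (𝓝 z)) {M θ : ℝ} (hM : 0 < M)
    (hθ : θ ∈ Ioo (0 : ℝ) 1) (hγθ : γ ≤ (3 * γ - 1) * θ)
    (hKL : ∀ᶠ y in 𝓝 z, M * |f y - f z| ^ θ ≤ G y) :
    Tendsto x atTop (𝓝 z) ∧ ∃ A, 0 ≤ A ∧ ∀ᶠ t : ℕ in atTop,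
      ‖x t - z‖ ≤ A * (w t ^ (1 - θ) + (t + b) ^ (-(2 * γ - 1))) := by
  obtain ⟨hb, ⟨hγ, hγ1⟩, hc, hC, -, hstep⟩ := h
  have hfs := hw.eq_of_accPoint hγ hf hφ hz
  have hθ1 : 0 < 1 - θ := by linarith [hθ.2]
  have hq : 0 < 2 * γ - 1 := by linarith
  set q := 2 * γ - 1 with hqdef
  set κ : ℝ := q * 2 ^ (-q - 1)
  have hκ : 0 < κ := by positivity
  have hU := hw.nonneg_const
  set A₁ : ℝ := C * (1 / (c * M * (1 - θ)))
  set A₂ : ℝ := (C * (M * U ^ θ) + C) / κ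
  have hA₁ : 0 ≤ A₁ := by positivity
  have hA₂ : 0 ≤ A₂ := by positivity
  set Δ : ℕ → ℝ := fun t => A₁ * w t ^ (1 - θ) + A₂ * (t + b) ^ (-q) with hΔdef
  have hΔ : Tendsto Δ atTop (𝓝 0) := by
    have h1 := (hw.tendsto.rpow_const (p := 1 - θ) (Or.inr hθ1.le)).const_mul A₁
    have h2 := (tendsto_natCast_add_rpow_neg (b := b) hq).const_mul A₂
    simpa [Real.zero_rpow hθ1.ne'] using h1.add h2
  have hΔ0 : ∀ᶠ t in atTop, 0 ≤ Δ t := by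
    filter_upwards [hw.nonneg] with t ht
    simp only [hΔdef]
    positivity
  have hmain : ∀ᶠ t in atTop, x t ∈ {y | M * |f y - f z| ^ θ ≤ G y} →
      ‖x (t + 1) - x t‖ ≤ Δ t - Δ (t + 1) := by
    filter_upwards [hstep, hw.decr, (tendsto_add_atTop_nat 1).eventually hw.nonneg]
      with t hst hdec hw' hmem
    have hs1 : 1 ≤ (t : ℝ) + b := by
      have : (0 : ℝ) ≤ t := by positivity
      linarith
    have hs : 0 < (t : ℝ) + b := by linarith
    have hwe := hw.eq t
    have hdiff := rpow_neg_sub_add_one_rpow_neg_ge hs1 hq.le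
    simp only [hΔdef]
    push_cast
    rw [show (t : ℝ) + 1 + b = t + b + 1 by ring]
    set s : ℝ := t + b
    have hlen := mul_le_rpow_sub_rpow_add (h := s ^ (-γ)) (c := c) (u := U * s ^ (-(3 * γ - 1)))
      (w := w t) (w' := w (t + 1)) hw' (by positivity) (abs_nonneg (f (x t) - f z))
      (by positivity) hc hM hθ (by rw [hwe, hfs]; gcongr; exact le_abs_self _) hmem hdec
    -- Here `hγθ` enters: it says `γ + (3γ-1)θ ≥ 2γ`.
    have hu : s ^ (-γ) * (U * s ^ (-(3 * γ - 1))) ^ θ ≤ U ^ θ * s ^ (-(2 * γ)) := by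
      rw [Real.mul_rpow hU (by positivity), ← Real.rpow_mul hs.le]
      calc _ = U ^ θ * (s ^ (-γ) * s ^ (-(3 * γ - 1) * θ)) := by ring
        _ ≤ _ := by
          rw [← Real.rpow_add hs]
          gcongr
          linarith
    have h1 := mul_le_mul_of_nonneg_left hlen hC
    have h2 := mul_le_mul_of_nonneg_left hu (show 0 ≤ C * M by positivity)
    have h3 : (C * (M * U ^ θ) + C) * s ^ (-(2 * γ)) ≤ A₂ * (s ^ (-q) - (s + 1) ^ (-q)) := by
      have := mul_le_mul_of_nonneg_left hdiff hA₂
      refine le_trans (le_of_eq ?_) this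
      have hA : A₂ * κ = C * (M * U ^ θ) + C := div_mul_cancel₀ _ hκ.ne'
      rw [← hA, mul_assoc, show -(2 * γ) = -q - 1 by rw [hqdef]; ring]
    have h4 : C * (1 / (c * M * (1 - θ)) * (w t ^ (1 - θ) - w (t + 1) ^ (1 - θ)))
      = A₁ * w t ^ (1 - θ) - A₁ * w (t + 1) ^ (1 - θ) := by ring
    linarith
  obtain ⟨hx, hbd⟩ := tendsto_of_norm_sub_le_decrement hφ hz hΔ hΔ0 hKL hmain
  refine ⟨hx, A₁ + A₂, by positivity, ?_⟩
  filter_upwards [hbd, hw.nonneg] with t ht hwt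
  have hs : 0 < (t : ℝ) + b := by positivity
  have h1 : 0 ≤ w t ^ (1 - θ) := by positivity
  have h2 : (0 : ℝ) ≤ (t + b) ^ (-q) := by positivity
  simp only [hΔdef] at ht
  nlinarith [mul_nonneg hA₁ h2, mul_nonneg hA₂ h1]

/-- Decay of the merit sequence under the KL inequality at the limit point. -/
theorem IsPerturbedDescent.merit_le_rpow (h : IsPerturbedDescent f G γ b c C x)
    {fs U : ℝ} {w : ℕ → ℝ} (hw : IsMerit f G γ b c x fs U w)
    {z : E} (hfs : fs = f z) (hz : Tendsto x atTop (𝓝 z)) {M θ p : ℝ} (hM : 0 < M)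
    (hθ : θ ∈ Ioo (0 : ℝ) 1) (hKL : ∀ᶠ y in 𝓝 z, M * |f y - f z| ^ θ ≤ G y)
    (hp : 0 < p) (hpθ : p * (2 * θ) + γ = p + 1) (hpγ : p + 1 ≤ γ + (3 * γ - 1) * (2 * θ))
    (hK : ∀ C' : ℝ, ∀ᶠ K : ℝ in atTop, K * p + C' ≤ c * M ^ 2 / 2 * (K / 2) ^ (2 * θ)) :
    ∃ K, ∀ᶠ t : ℕ in atTop, w t ≤ K * (t + b) ^ (-p) := by
  obtain ⟨hb, -, hc, -, -, -⟩ := h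
  have hU := hw.nonneg_const
  obtain ⟨hθ0, hθ1⟩ := hθ
  refine exists_eventually_le_rpow_of_recursion (c := c * M ^ 2 / 2) (q := 2 * θ) (γ := γ)
    (C := c * M ^ 2 * U ^ (2 * θ)) hb hp (by positivity) (by positivity) (by linarith) hpθ
    (hK _) hw.nonneg ?_
  filter_upwards [hw.nonneg, hw.decr, hz.eventually hKL] with t hwt hdec hkl
  have hs1 : 1 ≤ (t : ℝ) + b := by
    have : (0 : ℝ) ≤ t := by positivity
    linarith
  have hs : 0 < (t : ℝ) + b := by linarith
  have hwe := hw.eq t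
  set s : ℝ := t + b
  have hu0 : 0 ≤ U * s ^ (-(3 * γ - 1)) := by positivity
  have h1 : w t ^ θ ≤ |f (x t) - f z| ^ θ + (U * s ^ (-(3 * γ - 1))) ^ θ := by
    refine (Real.rpow_le_rpow hwt ?_ hθ0.le).trans
      (Real.rpow_add_le_add_rpow (abs_nonneg _) hu0 hθ0.le hθ1.le)
    rw [hwe, hfs]; gcongr; exact le_abs_self _
  have h2 : M * w t ^ θ ≤ G (x t) + M * (U * s ^ (-(3 * γ - 1))) ^ θ := by nlinarith
  have hsq : ∀ a : ℝ, 0 ≤ a → a ^ (2 * θ) = (a ^ θ) ^ 2 := fun a ha => by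
    rw [mul_comm, Real.rpow_mul ha, Real.rpow_two]
  have hA : 0 ≤ w t ^ θ := by positivity
  -- Squaring `h2` with `(a + b) ^ 2 ≤ 2 a ^ 2 + 2 b ^ 2` is the source of the factor `1/2` in the
  -- drift coefficient `c * M ^ 2 / 2`.
  have h3 : M ^ 2 * w t ^ (2 * θ) ≤
      2 * G (x t) ^ 2 + 2 * M ^ 2 * (U * s ^ (-(3 * γ - 1))) ^ (2 * θ) := by
    rw [hsq _ hwt, hsq _ hu0]
    set B := (U * s ^ (-(3 * γ - 1))) ^ θ
    calc M ^ 2 * (w t ^ θ) ^ 2 = (M * w t ^ θ) ^ 2 := by ring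
      _ ≤ (G (x t) + M * B) ^ 2 := by gcongr
      _ ≤ _ := by nlinarith [sq_nonneg (G (x t) - M * B)]
  have h4 : s ^ (-γ) * (U * s ^ (-(3 * γ - 1))) ^ (2 * θ) ≤ U ^ (2 * θ) * s ^ (-p - 1) := by
    rw [Real.mul_rpow hU (by positivity), ← Real.rpow_mul hs.le]
    calc _ = U ^ (2 * θ) * (s ^ (-γ) * s ^ (-(3 * γ - 1) * (2 * θ))) := by ring
      _ ≤ _ := by
        rw [← Real.rpow_add hs]
        gcongr
        linarith
  have h5 := mul_le_mul_of_nonneg_left h3 (show 0 ≤ c * s ^ (-γ) / 2 by positivity)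
  have h6 := mul_le_mul_of_nonneg_left h4 (show 0 ≤ c * M ^ 2 by positivity)
  linarith

theorem eventually_mul_add_le_mul_rpow {c p C r : ℝ} (hc : 0 < c) (hr : 1 < r) :
    ∀ᶠ K : ℝ in atTop, K * p + C ≤ c * (K / 2) ^ r := by
  have h1 : Tendsto (fun K : ℝ => (K / 2) ^ (r - 1)) atTop atTop :=
    (tendsto_rpow_atTop (by linarith)).comp (tendsto_id.atTop_div_const two_pos)
  filter_upwards [h1.eventually_ge_atTop ((|p| + |C|) * 2 / c), eventually_ge_atTop 1]
    with K hK hK1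
  have h2 : 0 < K / 2 := by linarith
  rw [Real.rpow_sub_one h2.ne', div_le_div_iff₀ hc h2] at hK
  nlinarith [le_abs_self p, le_abs_self C, abs_nonneg C, abs_nonneg p]

/-- Rate of convergence of a perturbed descent sequence. -/
theorem IsPerturbedDescent.norm_sub_le_rpow (h : IsPerturbedDescent f G γ b c C x)
    {fs U : ℝ} {w : ℕ → ℝ} (hw : IsMerit f G γ b c x fs U w)
    {z : E} (hf : ContinuousAt f z) (hz : Tendsto x atTop (𝓝 z)) {M θ p ψ : ℝ} (hM : 0 < M)
    (hθ : θ ∈ Ioo (0 : ℝ) 1) (hγθ : γ ≤ (3 * γ - 1) * θ)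
    (hKL : ∀ᶠ y in 𝓝 z, M * |f y - f z| ^ θ ≤ G y)
    (hp : 0 < p) (hpθ : p * (2 * θ) + γ = p + 1) (hpγ : p + 1 ≤ γ + (3 * γ - 1) * (2 * θ))
    (hK : ∀ C' : ℝ, ∀ᶠ K : ℝ in atTop, K * p + C' ≤ c * M ^ 2 / 2 * (K / 2) ^ (2 * θ))
    (hψp : ψ ≤ p * (1 - θ)) (hψγ : ψ ≤ 2 * γ - 1) :
    ∃ A, ∀ᶠ t : ℕ in atTop, ‖x t - z‖ ≤ A * (t + b) ^ (-ψ) := by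
  have hfs : fs = f z := hw.eq_of_accPoint h.mem_Ioc.1 hf strictMono_id hz
  obtain ⟨-, A, hA, hbd⟩ := h.tendsto_of_kl hw hf strictMono_id hz hM hθ hγθ hKL
  obtain ⟨K, hwK⟩ := h.merit_le_rpow hw hfs hz hM hθ hKL hp hpθ hpγ hK
  have hθ1 : 0 ≤ 1 - θ := by linarith [hθ.2]
  refine ⟨A * (|K| ^ (1 - θ) + 1), ?_⟩
  filter_upwards [hbd, hwK, hw.nonneg] with t h1 h2 h3
  have hs1 : 1 ≤ (t : ℝ) + b := by
    have : (0 : ℝ) ≤ t := by positivity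
    linarith [h.one_le]
  have hs : 0 < (t : ℝ) + b := by linarith
  set s : ℝ := t + b
  have h4 : w t ^ (1 - θ) ≤ |K| ^ (1 - θ) * s ^ (-ψ) := by
    have : w t ≤ |K| * s ^ (-p) :=
      h2.trans (mul_le_mul_of_nonneg_right (le_abs_self K) (by positivity))
    refine (Real.rpow_le_rpow h3 this hθ1).trans ?_
    rw [Real.mul_rpow (abs_nonneg K) (by positivity), ← Real.rpow_mul hs.le]
    gcongr
    linarith
  have h5 : s ^ (-(2 * γ - 1)) ≤ s ^ (-ψ) := by
    gcongr
  calc _ ≤ A * (w t ^ (1 - θ) + s ^ (-(2 * γ - 1))) := h1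
    _ ≤ A * (|K| ^ (1 - θ) * s ^ (-ψ) + s ^ (-ψ)) := by gcongr
    _ = _ := by ring

/-- As the step sizes are not summable, the gradient vanishes at the limit. -/
theorem IsMerit.eq_zero_of_tendsto {fs U : ℝ} {w : ℕ → ℝ} (hw : IsMerit f G γ b c x fs U w)
    (hb : 1 ≤ b) (hγ : γ ≤ 1) (hc : 0 < c) {z : E} (hG : ContinuousAt G z)
    (hz : Tendsto x atTop (𝓝 z)) : G z = 0 := by
  by_contra hne
  have hpos : 0 < G z ^ 2 := by positivity
  have hev : ∀ᶠ t in atTop, G z ^ 2 / 2 < G (x t) ^ 2 :=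
    ((hG.tendsto.comp hz).pow 2).eventually (lt_mem_nhds (half_lt_self hpos))
  set δ := c * (G z ^ 2 / 2)
  have hδ : 0 < δ := by positivity
  obtain ⟨T, hT⟩ := eventually_atTop.1 ((hev.and hw.decr).and hw.nonneg)
  -- The logarithm stands in for the divergent sum of `s ^ (-γ) ≥ s⁻¹`: a nonzero limit gradient
  -- would drive `w` to `-∞`.
  have hbound : ∀ t, T ≤ t → w t + δ * Real.log (t + b) ≤ w T + δ * Real.log (T + b) := by
    intro t ht
    induction t, ht using Nat.le_induction with
    | base => exact le_rfl
    | succ t ht ih =>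
      obtain ⟨⟨h1, h2⟩, -⟩ := hT t ht
      refine le_trans ?_ ih
      push_cast
      rw [show (t : ℝ) + 1 + b = t + b + 1 by ring]
      have hs1 : 1 ≤ (t : ℝ) + b := by
        have : (0 : ℝ) ≤ t := by positivity
        linarith
      set s : ℝ := t + b
      have hs : 0 < s := by linarith
      have h3 : s⁻¹ ≤ s ^ (-γ) := by
        rw [← Real.rpow_neg_one]
        gcongr
      have h4 : Real.log (s + 1) - Real.log s ≤ s⁻¹ := by
        rw [← Real.log_div (by positivity) hs.ne']
        refine (Real.log_le_sub_one_of_pos (by positivity)).trans (le_of_eq ?_)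
        field_simp
        ring
      have h5 : δ * s⁻¹ ≤ c * s ^ (-γ) * G (x t) ^ 2 := by
        calc δ * s⁻¹ = c * s⁻¹ * (G z ^ 2 / 2) := by ring
          _ ≤ _ := by gcongr
      nlinarith
  have hlog : Tendsto (fun t : ℕ => δ * Real.log (t + b)) atTop atTop :=
    (Real.tendsto_log_atTop.comp
      (tendsto_atTop_add_const_right _ b tendsto_natCast_atTop_atTop)).const_mul_atTop hδ
  obtain ⟨t, h1, h2⟩ := ((hlog.eventually_gt_atTop (w T + δ * Real.log (T + b))).and
    (eventually_ge_atTop T)).exists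
  linarith [hbound t h2, (hT t h2).2]

end

end ShuffledProx

namespace ShuffledProx

/-! ### Consequences of the KL inequality -/

section KL

variable {n : ℕ} {f : EuclideanSpace ℝ (Fin n) → ℝ} {z : EuclideanSpace ℝ (Fin n)} {Θ : ℝ}

/-- Differentiating `c s ^ (1-Θ)` gives `m = 1/(c(1-Θ))`, and continuity removes `η`. Positivity of
`|f y - f z|` must stay as a premise: for `Θ = 0` the convention `0 ^ 0 = 1` would make the bound a
claim at `z` itself. -/
theorem HasKLExponent.eventually_rpow_le (h : HasKLExponent f z Θ) (hf : ContinuousAt f z) :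
    ∃ m : ℝ, 0 < m ∧ ∀ᶠ y in 𝓝 z, 0 < |f y - f z| → m * |f y - f z| ^ Θ ≤ ‖gradient f y‖ := by
  obtain ⟨⟨-, hΘ1⟩, c, hc, η, hη, V, hV, hKL⟩ := h
  have hΘ : 0 < 1 - Θ := by linarith
  have hlim : Tendsto (fun y => |f y - f z|) (𝓝 z) (𝓝 0) := by
    simpa using (hf.tendsto.sub_const (f z)).abs
  have hlim' : ∀ᶠ y in 𝓝 z, ((|f y - f z| : ℝ) : EReal) < η :=
    ((continuous_coe_real_ereal.tendsto 0).comp hlim).eventually (gt_mem_nhds hη)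
  refine ⟨1 / (c * (1 - Θ)), by positivity, ?_⟩
  filter_upwards [hV, hlim'] with y hy hyη hpos
  have h1 := hKL y hy hpos hyη
  set s := |f y - f z|
  have h2 : deriv (lojasiewicz c Θ) s = c * ((1 - Θ) * s ^ (-Θ)) := by
    have := ((Real.hasDerivAt_rpow_const (p := 1 - Θ) (Or.inl hpos.ne')).const_mul c).deriv
    rw [show 1 - Θ - 1 = -Θ by ring] at this
    exact this
  rw [h2, Real.rpow_neg hpos.le] at h1
  have h3 : 0 < s ^ Θ := by positivity
  rw [div_mul_eq_mul_div, one_mul, div_le_iff₀ (by positivity)]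
  calc s ^ Θ = s ^ Θ * 1 := by ring
    _ ≤ s ^ Θ * (c * ((1 - Θ) * (s ^ Θ)⁻¹) * ‖gradient f y‖) := by gcongr
    _ = _ := by field_simp

/-- The KL exponent may be raised, and if it is raised strictly the constant is arbitrary. -/
theorem HasKLExponent.eventually_mul_rpow_le (h : HasKLExponent f z Θ) (hf : ContinuousAt f z)
    {θ : ℝ} (hθ : Θ < θ) (M : ℝ) :
    ∀ᶠ y in 𝓝 z, M * |f y - f z| ^ θ ≤ ‖gradient f y‖ := by
  have hθ0 : 0 < θ := h.1.1.trans_lt hθ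
  obtain ⟨m, hm, hev⟩ := h.eventually_rpow_le hf
  have hlim : Tendsto (fun y => M * |f y - f z| ^ (θ - Θ)) (𝓝 z) (𝓝 0) := by
    have h1 : Tendsto (fun y => |f y - f z|) (𝓝 z) (𝓝 0) := by
      simpa using (hf.tendsto.sub_const (f z)).abs
    have h2 := (h1.rpow_const (p := θ - Θ) (Or.inr (by linarith))).const_mul M
    simpa [Real.zero_rpow (sub_pos.2 hθ).ne'] using h2
  filter_upwards [hev, hlim.eventually (gt_mem_nhds hm)] with y hy hlt
  rcases (abs_nonneg (f y - f z)).eq_or_lt with h0 | h0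
  · rw [← h0, Real.zero_rpow hθ0.ne', mul_zero]
    positivity
  · refine le_trans ?_ (hy h0)
    rw [show θ = θ - Θ + Θ by ring, Real.rpow_add h0, ← mul_assoc]
    gcongr

theorem HasKLExponent.exists_eventually_mul_rpow_le (h : HasKLExponent f z Θ)
    (hf : ContinuousAt f z) {θ : ℝ} (hθ : Θ ≤ θ) (hθ0 : 0 < θ) :
    ∃ M : ℝ, 0 < M ∧ ∀ᶠ y in 𝓝 z, M * |f y - f z| ^ θ ≤ ‖gradient f y‖ := by
  rcases hθ.eq_or_lt with rfl | hlt
  · obtain ⟨m, hm, hev⟩ := h.eventually_rpow_le hf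
    refine ⟨m, hm, hev.mono fun y hy => ?_⟩
    rcases (abs_nonneg (f y - f z)).eq_or_lt with h0 | h0
    · rw [← h0, Real.zero_rpow hθ0.ne', mul_zero]
      positivity
    · exact hy h0
  · exact ⟨1, one_pos, h.eventually_mul_rpow_le hf hlt 1⟩

/-- A perturbed descent sequence with an accumulation point at which the KL inequality holds
converges to that point, which is stationary. -/
theorem IsPerturbedDescent.tendsto_of_hasKLExponent {γ b c C : ℝ}
    {x : ℕ → EuclideanSpace ℝ (Fin n)}
    (h : IsPerturbedDescent f (fun y => ‖gradient f y‖) γ b c C x)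
    (hbdd : BddBelow (range fun t => f (x t))) (hf : Continuous f)
    (hg : Continuous (gradient f)) (hz : z ∈ accPoints x) (hKL : HasKLExponent f z Θ) :
    Tendsto x atTop (𝓝 z) ∧ z ∈ crit f := by
  obtain ⟨φ, hφ, hlim⟩ := hz
  obtain ⟨fs, U, w, hw⟩ := h.exists_isMerit hbdd
  obtain ⟨hγ, hγ1⟩ := h.mem_Ioc
  have h3 : 0 < 3 * γ - 1 := by linarith
  have hthr : γ / (3 * γ - 1) < 1 := by rw [div_lt_one h3]; linarith
  have hthr0 : 0 < γ / (3 * γ - 1) := by positivity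
  set θ := max Θ (γ / (3 * γ - 1))
  have hθ0 : 0 < θ := hthr0.trans_le (le_max_right _ _)
  obtain ⟨M, hM, hev⟩ := hKL.exists_eventually_mul_rpow_le hf.continuousAt (le_max_left _ _) hθ0
  have hx := (h.tendsto_of_kl hw hf.continuousAt hφ hlim hM ⟨hθ0, max_lt hKL.1.2 hthr⟩
    (by rw [← div_le_iff₀' h3]; exact le_max_right _ _) hev).1
  exact ⟨hx, norm_eq_zero.1
    (hw.eq_zero_of_tendsto h.one_le hγ1 h.pos hg.norm.continuousAt hx)⟩

theorem exists_eventually_rpow_mul_norm_le {E : Type*} [NormedAddCommGroup E] {x : ℕ → E} {z : E}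
    {b ψ A : ℝ} (hb : 1 ≤ b) (hψ : 0 ≤ ψ)
    (h : ∀ᶠ t : ℕ in atTop, ‖x t - z‖ ≤ A * (t + b) ^ (-ψ)) :
    ∀ᶠ t : ℕ in atTop, (t : ℝ) ^ ψ * ‖x t - z‖ ≤ A := by
  filter_upwards [h] with t ht
  have hs : 0 < (t : ℝ) + b := by positivity
  calc (t : ℝ) ^ ψ * ‖x t - z‖ ≤ (t + b) ^ ψ * (A * (t + b) ^ (-ψ)) := by
        gcongr
        linarith
    _ = A * ((t + b) ^ ψ * (t + b) ^ (-ψ)) := by ring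
    _ = A := by rw [← Real.rpow_add hs]; simp

/-- Rate of convergence in terms of the KL exponent at the limit point. -/
theorem IsPerturbedDescent.rpow_rate_mul_norm_le {γ b c C : ℝ}
    {x : ℕ → EuclideanSpace ℝ (Fin n)}
    (h : IsPerturbedDescent f (fun y => ‖gradient f y‖) γ b c C x)
    (hbdd : BddBelow (range fun t => f (x t))) (hf : Continuous f)
    (hx : Tendsto x atTop (𝓝 z)) (hKL : HasKLExponent f z Θ) :
    ∃ A, ∀ᶠ t : ℕ in atTop, (t : ℝ) ^ rate γ Θ * ‖x t - z‖ ≤ A := by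
  obtain ⟨fs, U, w, hw⟩ := h.exists_isMerit hbdd
  obtain ⟨hγ, hγ1⟩ := h.mem_Ioc
  have h3 : 0 < 3 * γ - 1 := by linarith
  have hc := h.pos
  have hzero : ∃ A, ∀ᶠ t : ℕ in atTop, (t : ℝ) ^ (0 : ℝ) * ‖x t - z‖ ≤ A := by
    refine ⟨1, ?_⟩
    filter_upwards [(tendsto_iff_norm_sub_tendsto_zero.1 hx).eventually (gt_mem_nhds one_pos)]
      with t ht
    rw [Real.rpow_zero, one_mul]
    exact ht.le
  rcases hγ1.eq_or_lt with rfl | hlt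
  · by_cases hΘ : Θ < 1 / 2
    · have hr : rate 1 Θ = 1 := by
        rw [rate, if_pos (by norm_num; linarith)]; norm_num
      rw [hr]
      -- With `2θ = 1` the drift is linear in `K`, so the Chung condition needs `c M ^ 2 / 4 > p =
      -- 2`. As `Θ < 1/2` strictly, `M` is free; this choice makes the drift `3 K`.
      set M : ℝ := Real.sqrt (12 / c)
      have hM : 0 < M := Real.sqrt_pos.2 (by positivity)
      have hM2 : c * M ^ 2 = 12 := by
        rw [Real.sq_sqrt (by positivity)]; field_simp
      obtain ⟨A, hA⟩ := h.norm_sub_le_rpow hw hf.continuousAt hx (M := M) (θ := 1 / 2) (p := 2)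
        (ψ := 1) hM ⟨by norm_num, by norm_num⟩ (by norm_num)
        (hKL.eventually_mul_rpow_le hf.continuousAt hΘ M) (by norm_num) (by norm_num)
        (by norm_num) (fun C' => by
          filter_upwards [eventually_ge_atTop C'] with K hK
          rw [hM2, show (2 : ℝ) * (1 / 2) = 1 by norm_num, Real.rpow_one]
          linarith) (by norm_num) (by norm_num)
      exact ⟨A, exists_eventually_rpow_mul_norm_le h.one_le zero_le_one hA⟩
    · have hr : rate 1 Θ = 0 := by
        rw [rate, if_neg (by norm_num; linarith)]
        split_ifs <;> simp
      rw [hr]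
      exact hzero
  · have hhalf : 1 / 2 < γ / (3 * γ - 1) := by rw [lt_div_iff₀ h3]; linarith
    have hthr : γ / (3 * γ - 1) < 1 := by rw [div_lt_one h3]; linarith
    set θ := max Θ (γ / (3 * γ - 1)) with hθdef
    have hθge : γ / (3 * γ - 1) ≤ θ := le_max_right _ _
    have hθ2 : 0 < 2 * θ - 1 := by linarith
    have hθ1 : θ < 1 := max_lt hKL.1.2 hthr
    have hγθ : γ ≤ (3 * γ - 1) * θ := by rwa [← div_le_iff₀' h3]
    -- Both branches of `rate` agree with one formula in the raised exponent: at `θ = γ/(3γ-1)` it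
    -- equals `2γ - 1`.
    have hr : rate γ Θ = (1 - θ) * (1 - γ) / (2 * θ - 1) := by
      by_cases hΘ : Θ < γ / (3 * γ - 1)
      · have e : (3 * γ - 1) * θ = γ := by
          rw [hθdef, max_eq_right hΘ.le]; field_simp
        rw [rate, if_pos hΘ, eq_div_iff hθ2.ne']
        linear_combination 2 * e - e
      · have e : θ = Θ := max_eq_left (not_lt.1 hΘ)
        rw [rate, if_neg hΘ, if_pos (by simp [Prod.ext_iff, hlt.ne]), e]
    have h1γ : 0 < 1 - γ := by linarith
    set p := (1 - γ) / (2 * θ - 1) with hp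
    have hp0 : 0 < p := by positivity
    have hpe : p * (2 * θ - 1) = 1 - γ := div_mul_cancel₀ _ hθ2.ne'
    have hrp : rate γ Θ = p * (1 - θ) := by rw [hr, hp]; ring
    have hple : p ≤ 3 * γ - 1 := by
      rw [hp, div_le_iff₀ hθ2]; linarith
    obtain ⟨M, hM, hev⟩ := hKL.exists_eventually_mul_rpow_le hf.continuousAt
      (le_max_left Θ (γ / (3 * γ - 1))) (by linarith)
    obtain ⟨A, hA⟩ := h.norm_sub_le_rpow hw hf.continuousAt hx (M := M) (θ := θ) (p := p)
      (ψ := rate γ Θ) hM ⟨by linarith, hθ1⟩ hγθ hev hp0 (by linarith)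
      (by nlinarith) (fun C' => eventually_mul_add_le_mul_rpow (by positivity) (by linarith))
      hrp.le (by rw [hr, div_le_iff₀ hθ2]; nlinarith)
    refine ⟨A, exists_eventually_rpow_mul_norm_le h.one_le ?_ hA⟩
    rw [hrp]
    exact mul_nonneg hp0.le (by linarith)

end KL

/-! ### The shuffled proximal point method, path by path -/

section Prox

variable {n N : ℕ}

theorem IsProx.sub_eq {g : EuclideanSpace ℝ (Fin n) → ℝ} {a : ℝ}
    {y z : EuclideanSpace ℝ (Fin n)} (h : IsProx g a y z) (ha : 0 < a)
    (hg : DifferentiableAt ℝ g z) : z - y = -(a • gradient g z) := by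
  have h1 : HasFDerivAt (fun x => ‖x - y‖ ^ 2)
      (2 • (innerSL ℝ (z - y)).comp (ContinuousLinearMap.id ℝ _)) z :=
    ((hasFDerivAt_id z).sub_const y).norm_sq
  have h2 := hg.hasFDerivAt.add (h1.const_mul (1 / (2 * a)))
  have h3 := (h.isLocalMin univ_mem).hasFDerivAt_eq_zero h2
  refine ext_inner_right ℝ fun v => ?_
  have h4 := congrArg (fun l => l v) h3
  have h5 : inner ℝ (gradient g z) v = fderiv ℝ g z v := inner_gradient_left
  simp at h4
  rw [inner_neg_left, inner_smul_left, h5]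
  simp only [conj_trivial]
  rw [inner_sub_left]
  field_simp at h4
  linarith

theorem hasGradientAt_objective {F : Fin N → EuclideanSpace ℝ (Fin n) → ℝ}
    (hF : ∀ i, Differentiable ℝ (F i)) (x : EuclideanSpace ℝ (Fin n)) :
    HasGradientAt (objective F) ((1 / (N : ℝ)) • ∑ i, gradient (F i) x) x := by
  rw [hasGradientAt_iff_hasFDerivAt, map_smul, map_sum]
  simp only [toDual_gradient]
  exact (HasFDerivAt.fun_sum fun i _ => (hF i x).hasFDerivAt).const_mul _

theorem gradient_objective {F : Fin N → EuclideanSpace ℝ (Fin n) → ℝ}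
    (hF : ∀ i, Differentiable ℝ (F i)) :
    gradient (objective F) = fun x => (1 / (N : ℝ)) • ∑ i, gradient (F i) x :=
  funext fun x => (hasGradientAt_objective hF x).gradient

theorem lipschitzWith_gradient_objective (hN : 0 < N)
    {F : Fin N → EuclideanSpace ℝ (Fin n) → ℝ}
    (hF : ∀ i, Differentiable ℝ (F i)) {L : ℝ≥0} (hL : ∀ i, LipschitzWith L (gradient (F i))) :
    LipschitzWith L (gradient (objective F)) := by
  rw [gradient_objective hF]
  refine LipschitzWith.of_dist_le_mul fun x y => ?_
  have hN' : (0 : ℝ) < N := by exact_mod_cast hN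
  rw [dist_eq_norm, ← smul_sub, ← Finset.sum_sub_distrib, norm_smul, dist_eq_norm]
  calc _ ≤ ‖1 / (N : ℝ)‖ * ∑ _i : Fin N, (L : ℝ) * ‖x - y‖ := by
        gcongr
        exact norm_sum_le_of_le _ fun i _ => (hL i).norm_sub_le x y
    _ = _ := by
        rw [Real.norm_of_nonneg (by positivity), Finset.sum_const, Finset.card_univ,
          Fintype.card_fin, nsmul_eq_mul]
        field_simp

theorem bddBelow_range_objective {F : Fin N → EuclideanSpace ℝ (Fin n) → ℝ}
    (h : ∀ i, BddBelow (range (F i))) : BddBelow (range (objective F)) := by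
  choose B hB using h
  refine ⟨1 / (N : ℝ) * ∑ i, B i, ?_⟩
  rintro _ ⟨x, rfl⟩
  exact mul_le_mul_of_nonneg_left (Finset.sum_le_sum fun i _ => hB i ⟨x, rfl⟩) (by positivity)

/-- The mean value inequality on a ball suffices, giving `L` in place of the sharp `L / 2`; the
constant is immaterial below. -/
theorem le_add_inner_add_sq_of_lipschitzWith {f : EuclideanSpace ℝ (Fin n) → ℝ}
    (hf : Differentiable ℝ f) {L : ℝ≥0} (hL : LipschitzWith L (gradient f))
    (x y : EuclideanSpace ℝ (Fin n)) :
    f y ≤ f x + inner ℝ (gradient f x) (y - x) + L * ‖y - x‖ ^ 2 := by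
  have h1 := (convex_closedBall x ‖y - x‖).norm_image_sub_le_of_norm_fderiv_le' (𝕜 := ℝ)
    (f := f) (φ := fderiv ℝ f x) (C := L * ‖y - x‖) (y := y) (fun z _ => hf z) (fun z hz => by
      rw [← toDual_gradient, ← toDual_gradient, ← map_sub, LinearIsometryEquiv.norm_map]
      refine (hL.norm_sub_le z x).trans ?_
      gcongr
      simpa [dist_eq_norm] using hz) (Metric.mem_closedBall_self (norm_nonneg _))
      (by simp [dist_eq_norm])
  have h2 := (le_abs_self _).trans h1
  rw [inner_gradient_left]
  nlinarith

/-- One epoch of implicit steps is a gradient step up to an error of second order. -/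
theorem norm_implicit_epoch_le {E : Type*} [NormedAddCommGroup E] [NormedSpace ℝ E]
    {g : Fin N → E → E} {L : ℝ≥0} (hL : ∀ i, LipschitzWith L (g i)) {π : Equiv.Perm (Fin N)}
    {z : ℕ → E} {a B : ℝ} (ha : 0 < a) (haL : a * L ≤ 1 / 2)
    (hB : ∀ i, ‖g i (z 0)‖ ≤ B) (hB0 : 0 ≤ B)
    (hz : ∀ i : Fin N, z (i + 1) - z i = -(a • g (π i) (z (i + 1)))) :
    ‖z N - z 0 + a • ∑ i, g i (z 0)‖ ≤ N * L * 2 ^ (N + 1) * B * a ^ 2 := by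
  -- Since `a L ≤ 1/2`, the implicit term is absorbed on the left, leaving `d (i + 1) ≤ 2 d i + 2 a
  -- B`, whose solution from `d 0 = 0` is this bound.
  have hdrift : ∀ i : ℕ, i ≤ N → ‖z i - z 0‖ ≤ (2 ^ (i + 1) - 2) * (a * B) := by
    intro i hi
    induction i with
    | zero => simp
    | succ i ih =>
      have h1 := ih (by omega)
      have h2 := hz ⟨i, by omega⟩
      simp only at h2
      set j := π ⟨i, by omega⟩
      have h3 : ‖g j (z (i + 1))‖ ≤ B + L * ‖z (i + 1) - z 0‖ := by
        have h4 := (hL j).norm_sub_le (z (i + 1)) (z 0)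
        have h5 := norm_le_norm_add_norm_sub' (g j (z (i + 1))) (g j (z 0))
        linarith [hB j]
      have h4 : ‖z (i + 1) - z 0‖ ≤ ‖z i - z 0‖ + a * ‖g j (z (i + 1))‖ := by
        rw [show z (i + 1) - z 0 = (z i - z 0) + -(a • g j (z (i + 1))) by rw [← h2]; abel]
        refine (norm_add_le _ _).trans ?_
        rw [norm_neg, norm_smul, Real.norm_of_nonneg ha.le]
      have h5 : a * L * ‖z (i + 1) - z 0‖ ≤ 1 / 2 * ‖z (i + 1) - z 0‖ := by gcongr
      rw [pow_succ]
      nlinarith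
  have hsum : z N - z 0 = ∑ i : Fin N, -(a • g (π i) (z (i + 1))) := by
    rw [← Finset.sum_range_sub, ← Fin.sum_univ_eq_sum_range (fun i => z (i + 1) - z i)]
    exact Finset.sum_congr rfl fun i _ => hz i
  -- At the frozen point `z 0` the sum can be reindexed by `π`, so the leading term does not depend
  -- on the permutation.
  rw [hsum, ← Equiv.sum_comp π (fun i => g i (z 0)), Finset.smul_sum, ← Finset.sum_add_distrib]
  calc _ ≤ ∑ _i : Fin N, a * (L * (2 ^ (N + 1) * (a * B))) := by
        refine norm_sum_le_of_le _ fun i _ => ?_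
        rw [neg_add_eq_sub, ← smul_sub, norm_smul, Real.norm_of_nonneg ha.le, norm_sub_rev]
        gcongr
        refine ((hL (π i)).norm_sub_le _ _).trans ?_
        gcongr
        refine (hdrift (i + 1) i.2).trans ?_
        gcongr
        have : (2 : ℝ) ^ ((i : ℕ) + 1 + 1) ≤ 2 ^ (N + 1) :=
          pow_le_pow_right₀ one_le_two (by omega)
        linarith
    _ = _ := by
        rw [Finset.sum_const, Finset.card_univ, Fintype.card_fin, nsmul_eq_mul]
        ring

/-- An inexact gradient step: the cross term (by Young) and the quadratic term (by `8 L h ≤ 1`) each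
cost `h / 4 * ‖∇f‖ ^ 2`, leaving half of the decrease. -/
theorem le_sub_of_norm_add_smul_gradient_le {f : EuclideanSpace ℝ (Fin n) → ℝ}
    (hf : Differentiable ℝ f) {L : ℝ≥0} (hL : LipschitzWith L (gradient f))
    {x y : EuclideanSpace ℝ (Fin n)} {h D : ℝ} (hh : 0 < h) (hhL : 8 * (L * h) ≤ 1)
    (hxy : ‖y - x + h • gradient f x‖ ≤ D * h ^ 2) :
    f y ≤ f x - h / 2 * ‖gradient f x‖ ^ 2 + 2 * D ^ 2 * h ^ 3 ∧
      ‖y - x‖ ≤ h * ‖gradient f x‖ + D * h ^ 2 := by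
  set g := gradient f x
  set e := y - x + h • g
  have he : y - x = e - h • g := by simp [e]
  have hn : ‖y - x‖ ≤ h * ‖g‖ + D * h ^ 2 := by
    rw [he]
    refine (norm_sub_le _ _).trans ?_
    rw [norm_smul, Real.norm_of_nonneg hh.le]
    linarith
  refine ⟨?_, hn⟩
  have h1 := le_add_inner_add_sq_of_lipschitzWith hf hL x y
  have h2 : inner ℝ g (y - x) ≤ ‖g‖ * (D * h ^ 2) - h * ‖g‖ ^ 2 := by
    rw [he, inner_sub_right, inner_smul_right, real_inner_self_eq_norm_sq]
    have := (real_inner_le_norm g e).trans (mul_le_mul_of_nonneg_left hxy (norm_nonneg g))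
    linarith
  have h3 : ‖y - x‖ ^ 2 ≤ 2 * h ^ 2 * (‖g‖ ^ 2 + D ^ 2 * h ^ 2) := by
    refine (pow_le_pow_left₀ (norm_nonneg _) hn 2).trans ?_
    nlinarith [sq_nonneg (h * ‖g‖ - D * h ^ 2)]
  have h4 : L * ‖y - x‖ ^ 2 ≤ h / 4 * (‖g‖ ^ 2 + D ^ 2 * h ^ 2) := by
    calc L * ‖y - x‖ ^ 2 ≤ L * (2 * h ^ 2 * (‖g‖ ^ 2 + D ^ 2 * h ^ 2)) := by gcongr
      _ = 8 * (L * h) * (h / 4 * (‖g‖ ^ 2 + D ^ 2 * h ^ 2)) := by ring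
      _ ≤ 1 * (h / 4 * (‖g‖ ^ 2 + D ^ 2 * h ^ 2)) := by gcongr
      _ = _ := one_mul _
  have h5 : ‖g‖ * (D * h ^ 2) ≤ h * (‖g‖ ^ 2 / 4 + D ^ 2 * h ^ 2) := by
    nlinarith [mul_nonneg hh.le (sq_nonneg (‖g‖ / 2 - D * h))]
  have h6 : 0 ≤ D ^ 2 * h ^ 3 := by positivity
  nlinarith

/-- Bounded paths of the shuffled proximal point method are perturbed descent sequences. -/
theorem isPerturbedDescent_of_isProx (hN : 0 < N)
    {F : Fin N → EuclideanSpace ℝ (Fin n) → ℝ} (hF : ∀ i, Differentiable ℝ (F i))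
    {L : ℝ≥0} (hL : ∀ i, LipschitzWith L (gradient (F i)))
    {α β γ : ℝ} (hα : 0 < α) (hβ : 0 ≤ β) (hγ : γ ∈ Ioc (1 / 2 : ℝ) 1)
    {σ : ℕ → Equiv.Perm (Fin N)} {inner : ℕ → ℕ → EuclideanSpace ℝ (Fin n)}
    {x : ℕ → EuclideanSpace ℝ (Fin n)} (hbdd : BddAbove (range fun t => ‖x t‖))
    (hinit : ∀ t, inner (t + 1) 0 = x t) (hend : ∀ t, x (t + 1) = inner (t + 1) N)
    (hstep : ∀ t (i : Fin N), IsProx (F (σ (t + 1) i)) (stepSize α β γ (t + 1))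
      (inner (t + 1) i) (inner (t + 1) (i + 1))) :
    ∃ c C, IsPerturbedDescent (objective F) (fun y => ‖gradient (objective F) y‖) γ (1 + β)
      c C x := by
  obtain ⟨R, hR⟩ := hbdd
  have hN' : (1 : ℝ) ≤ N := by exact_mod_cast hN
  have hR0 : 0 ≤ R := (norm_nonneg _).trans (hR ⟨0, rfl⟩)
  set B : ℝ := ∑ i, ‖gradient (F i) 0‖ + L * R
  have hB0 : 0 ≤ B := by positivity
  have hB : ∀ t i, ‖gradient (F i) (x t)‖ ≤ B := by
    intro t i
    have h1 := (hL i).norm_sub_le (x t) 0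
    have h2 := norm_le_norm_add_norm_sub' (gradient (F i) (x t)) (gradient (F i) 0)
    have h3 : ‖gradient (F i) 0‖ ≤ ∑ i, ‖gradient (F i) 0‖ :=
      Finset.single_le_sum (f := fun i => ‖gradient (F i) 0‖) (fun _ _ => norm_nonneg _)
        (Finset.mem_univ i)
    have h4 : (L : ℝ) * ‖x t - 0‖ ≤ L * R := by
      rw [sub_zero]; gcongr; exact hR ⟨t, rfl⟩
    linarith
  set D : ℝ := N * L * 2 ^ (N + 1) * B
  have hD0 : 0 ≤ D := by positivity
  set H : ℝ := N * α
  have hH0 : 0 < H := by positivity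
  have hfd : Differentiable ℝ (objective F) := fun y =>
    (hasGradientAt_objective hF y).differentiableAt
  have hfL := lipschitzWith_gradient_objective hN hF hL
  have hev : ∀ᶠ t : ℕ in atTop, 8 * (L * (H * (t + (1 + β)) ^ (-γ))) ≤ 1 := by
    have h1 := (tendsto_natCast_add_rpow_neg (b := 1 + β) (q := γ)
      (by linarith [hγ.1])).const_mul (8 * (L * H))
    rw [mul_zero] at h1
    filter_upwards [h1.eventually (gt_mem_nhds one_pos)] with t ht
    linarith
  have hmain : ∀ᶠ t : ℕ in atTop,
      objective F (x (t + 1)) ≤ objective F (x t) - H * (t + (1 + β)) ^ (-γ) / 2 *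
        ‖gradient (objective F) (x t)‖ ^ 2 + 2 * D ^ 2 * (H * (t + (1 + β)) ^ (-γ)) ^ 3 ∧
      ‖x (t + 1) - x t‖ ≤ H * (t + (1 + β)) ^ (-γ) * ‖gradient (objective F) (x t)‖ +
        D * (H * (t + (1 + β)) ^ (-γ)) ^ 2 := by
    filter_upwards [hev] with t ht
    have hs : 0 < (t : ℝ) + (1 + β) := by positivity
    -- The step from `x t` uses `α_{t+1}`, hence the shift `b = 1 + β`.
    have ha : stepSize α β γ (t + 1) = α * (t + (1 + β)) ^ (-γ) := by
      rw [stepSize, Real.rpow_neg hs.le, div_eq_mul_inv]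
      push_cast
      rw [add_assoc]
    have hHa : H * (t + (1 + β)) ^ (-γ) = N * stepSize α β γ (t + 1) := by rw [ha]; ring
    rw [hHa] at ht ⊢
    have ha0 : 0 < stepSize α β γ (t + 1) := by rw [ha]; positivity
    have hproxstep := hstep t
    set a := stepSize α β γ (t + 1)
    have haL : a * L ≤ 1 / 2 := by
      have : a * L ≤ N * (a * L) := le_mul_of_one_le_left (by positivity) hN'
      nlinarith
    have hepoch := norm_implicit_epoch_le hL (π := σ (t + 1)) (z := inner (t + 1)) ha0 haL
      (B := B) (by rw [hinit]; exact hB t) hB0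
      (fun i => (hproxstep i).sub_eq ha0 (hF _ _))
    rw [← hend, hinit] at hepoch
    refine le_sub_of_norm_add_smul_gradient_le hfd hfL (by positivity) ht ?_
    have hg : ((N : ℝ) * a) • gradient (objective F) (x t) = a • ∑ i, gradient (F i) (x t) := by
      rw [gradient_objective hF, smul_smul]
      congr 1
      field_simp
    rw [hg]
    refine hepoch.trans ?_
    change D * a ^ 2 ≤ D * (N * a) ^ 2
    gcongr
    exact le_mul_of_one_le_left ha0.le hN'
  have hpow : ∀ t : ℕ, ∀ k : ℕ,
      (((t : ℝ) + (1 + β)) ^ (-γ)) ^ k = (t + (1 + β)) ^ (-(k * γ)) := by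
    intro t k
    rw [← Real.rpow_natCast, ← Real.rpow_mul (by positivity)]
    congr 1; ring
  refine ⟨H / 2, H + D * H ^ 2 + 2 * D ^ 2 * H ^ 3, by linarith, hγ, by positivity,
    by positivity, ?_, ?_⟩
  · filter_upwards [hmain] with t ht
    refine ht.1.trans ?_
    have h3 := hpow t 3
    norm_num at h3
    rw [mul_pow H, h3]
    have h4 : 0 ≤ (H + D * H ^ 2) * ((t : ℝ) + (1 + β)) ^ (-(3 * γ)) := by positivity
    linarith
  · filter_upwards [hmain] with t ht
    refine ht.2.trans ?_
    have h2 := hpow t 2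
    norm_num at h2
    rw [mul_pow H, h2]
    have h4 : 0 ≤ (H + 2 * D ^ 2 * H ^ 3) * ((t : ℝ) + (1 + β)) ^ (-(2 * γ)) := by positivity
    have h5 : 0 ≤ (D * H ^ 2 + 2 * D ^ 2 * H ^ 3) *
      (((t : ℝ) + (1 + β)) ^ (-γ) * ‖gradient (objective F) (x t)‖) := by positivity
    linarith

end Prox

end ShuffledProx

/-! ### Almost sure convergence, measurability of the limit, and the rate -/

theorem mainTheorem4 {Ω : Type*} [MeasurableSpace Ω] (P : Measure Ω) [IsProbabilityMeasure P]
    {n N : ℕ} (hN : 0 < N)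
    (F : Fin N → EuclideanSpace ℝ (Fin n) → ℝ)
    (hC1 : ∀ i, ContDiff ℝ 1 (F i))
    (hbelow : ∀ i, BddBelow (range (F i)))
    (L : ℝ≥0) (hLip : ∀ i, LipschitzWith L (gradient (F i)))
    (α β γ : ℝ) (hα : 0 < α) (hβ : 0 ≤ β) (hγ : γ ∈ Ioc (1 / 2 : ℝ) 1)
    (x0 : EuclideanSpace ℝ (Fin n)) (σ : ℕ → Ω → Equiv.Perm (Fin N))
    (inner : ℕ → Ω → ℕ → EuclideanSpace ℝ (Fin n))
    (X : ℕ → Ω → EuclideanSpace ℝ (Fin n))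
    (hX : ShuffledProx.IsShuffledProximalPoint P F (ShuffledProx.stepSize α β γ) x0 σ inner X)
    (hbounded : ∀ᵐ ω ∂P, BddAbove (range fun t => ‖X t ω‖))
    (hKL : ∃ K : Set Ω, MeasurableSet K ∧ P K = 1 ∧
      ∀ xbar ∈ ⋃ ω ∈ K, ShuffledProx.accPoints (fun t => X t ω),
        ∃ θ, ShuffledProx.HasKLExponent (ShuffledProx.objective F) xbar θ) :
    ∃ Xstar : Ω → EuclideanSpace ℝ (Fin n),
      Measurable Xstar ∧
      (∀ ω, Xstar ω ∈ ShuffledProx.crit (ShuffledProx.objective F)) ∧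
      (∀ᵐ ω ∂P, Tendsto (fun t => X t ω) atTop (𝓝 (Xstar ω))) ∧
      (∀ᵐ ω ∂P, ∃ θ, ShuffledProx.HasKLExponent (ShuffledProx.objective F) (Xstar ω) θ) ∧
      ∀ Θ : Ω → ℝ,
        (∀ᵐ ω ∂P, ShuffledProx.HasKLExponent (ShuffledProx.objective F) (Xstar ω) (Θ ω)) →
        ∀ᵐ ω ∂P,
          limsup (fun t : ℕ =>
            (((t : ℝ) ^ ShuffledProx.rate γ (Θ ω) * ‖X t ω - Xstar ω‖ : ℝ) : EReal)) atTop < ⊤ := by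
  have hF : ∀ i, Differentiable ℝ (F i) := fun i => (hC1 i).differentiable one_ne_zero
  have hfc : Continuous (ShuffledProx.objective F) := continuous_iff_continuousAt.2 fun x =>
    (ShuffledProx.hasGradientAt_objective hF x).continuousAt
  have hgc : Continuous (gradient (ShuffledProx.objective F)) :=
    (ShuffledProx.lipschitzWith_gradient_objective hN hF hLip).continuous
  have hfb : ∀ ω, BddBelow (range fun t => ShuffledProx.objective F (X t ω)) := fun ω =>
    (ShuffledProx.bddBelow_range_objective hbelow).mono
      (range_subset_iff.2 fun t => mem_range_self (X t ω))
  have hdesc : ∀ᵐ ω ∂P, ∃ c C, ShuffledProx.IsPerturbedDescent (ShuffledProx.objective F)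
      (fun y => ‖gradient (ShuffledProx.objective F) y‖) γ (1 + β) c C (fun t => X t ω) := by
    filter_upwards [hbounded] with ω hω
    exact ShuffledProx.isPerturbedDescent_of_isProx hN hF hLip hα hβ hγ
      (σ := fun t => σ t ω) (inner := fun t => inner t ω) hω
      (fun t => hX.inner_zero t ω) (fun t => hX.iterate_succ t ω) (fun t i => hX.inner_step t ω i)
  obtain ⟨K, hKm, hK1, hKKL⟩ := hKL
  have hKae : ∀ᵐ ω ∂P, ω ∈ K := (mem_ae_iff_prob_eq_one hKm).2 hK1
  have hconv : ∀ᵐ ω ∂P, ∃ z, Tendsto (fun t => X t ω) atTop (𝓝 z) ∧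
      z ∈ ShuffledProx.crit (ShuffledProx.objective F) ∧
      ∃ θ, ShuffledProx.HasKLExponent (ShuffledProx.objective F) z θ := by
    filter_upwards [hdesc, hbounded, hKae] with ω ⟨c, C, hω⟩ ⟨R, hR⟩ hωK
    obtain ⟨z, -, φ, hφ, hz⟩ := tendsto_subseq_of_bounded (Metric.isBounded_closedBall (x := 0)
      (r := R)) (x := fun t => X t ω) (fun t => mem_closedBall_zero_iff.2 (hR ⟨t, rfl⟩))
    have hacc : z ∈ ShuffledProx.accPoints (fun t => X t ω) := ⟨φ, hφ, hz⟩
    obtain ⟨θ, hθ⟩ := hKKL z (mem_biUnion hωK hacc)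
    obtain ⟨h1, h2⟩ := hω.tendsto_of_hasKLExponent (hfb ω) hfc hgc hacc hθ
    exact ⟨z, h1, h2, θ, hθ⟩
  -- Some path converges, so a critical point `z₀` exists; it is the value of `Xstar` wherever the
  -- measurable limit `Y` is not critical.
  obtain ⟨_, z₀, -, hz₀, -⟩ := hconv.exists
  obtain ⟨Y, hYm, hY⟩ := measurable_limit_of_tendsto_metrizable_ae
    (fun t => (hX.measurable_iterate t).aemeasurable) (hconv.mono fun ω ⟨z, hz, _⟩ => ⟨z, hz⟩)
  have hcrit : MeasurableSet (ShuffledProx.crit (ShuffledProx.objective F)) :=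
    (isClosed_eq hgc continuous_const).measurableSet
  classical
  set Xstar : Ω → EuclideanSpace ℝ (Fin n) :=
    (Y ⁻¹' ShuffledProx.crit (ShuffledProx.objective F)).piecewise Y fun _ => z₀ with hXstar
  have hlim : ∀ᵐ ω ∂P, Tendsto (fun t => X t ω) atTop (𝓝 (Xstar ω)) ∧
      ∃ θ, ShuffledProx.HasKLExponent (ShuffledProx.objective F) (Xstar ω) θ := by
    filter_upwards [hconv, hY] with ω ⟨z, hz, hzc, hzKL⟩ hYω
    have hYz : Y ω = z := tendsto_nhds_unique hYω hz
    have : Xstar ω = z := by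
      rw [hXstar, piecewise_eq_of_mem _ _ _ (by rwa [mem_preimage, hYz]), hYz]
    rw [this]
    exact ⟨hz, hzKL⟩
  refine ⟨Xstar, hYm.piecewise (hYm hcrit) measurable_const, fun ω => ?_,
    hlim.mono fun _ h => h.1, hlim.mono fun _ h => h.2, fun Θ hΘ => ?_⟩
  · by_cases h : ω ∈ Y ⁻¹' ShuffledProx.crit (ShuffledProx.objective F)
    · rw [hXstar, piecewise_eq_of_mem _ _ _ h]
      exact h
    · rw [hXstar, piecewise_eq_of_notMem _ _ _ h]
      exact hz₀
  · filter_upwards [hdesc, hlim, hΘ] with ω ⟨c, C, hω⟩ ⟨hx, _⟩ hΘω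
    obtain ⟨A, hA⟩ := hω.rpow_rate_mul_norm_le (hfb ω) hfc hx hΘω
    refine lt_of_le_of_lt (limsup_le_of_le (by isBoundedDefault) ?_) (EReal.coe_lt_top A)
    filter_upwards [hA] with t ht
    exact EReal.coe_le_coe_iff.2 ht
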